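/- Let $n\ge 0$ be an integer. Let $X=\begin{bmatrix}0&1\\1&0\end{bmatrix}$, $H=\frac{1}{\sqrt2}\begin{bmatrix}1&1\\1&-1\end{bmatrix}$, $CX=I_2\oplus X$ and $CCX=I_6\oplus X$, acting on $1$, $1$, $2$ and $3$ qubits respectively. A circuit on $N$ qubits over the gate set $\mathcal G=\{X,CX,CCX,H\otimes H\}$ is a finite composition of gates of $\mathcal G$, each applied to some ordered tuple of distinct qubits and tensored with the identity on the remaining qubits. A complex $2^n\times 2^n$ matrix $V$ is exactly represented by a circuit $D$ on $n+m$ qubits, using $m$ clean ancillas, if $D|\psi\rangle|0\rangle^{\otimes m}=(V|\psi\rangle)|0\rangle^{\otimes m}$ for every $n$-qubit state $|\psi\rangle$; $V$ can be exactly represented by an $n$-qubit circuit over $\mathcal G$ if this holds for some $m\ge 0$ and some circuit $D$ on $n+m$ qubits over $\mathcal G$. Let $\mathbb{Z}[1/2]=\{u/2^q : u\in\mathbb{Z},\ q\in\mathbb{N}\}$, and let $U_{2^n}(\mathbb{Z}[1/2])$ be the group of unitary $2^n\times 2^n$ matrices with all entries in $\mathbb{Z}[1/2]$. Then a complex $2^n\times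 2^n$ matrix $V$ can be exactly represented by an $n$-qubit circuit over $\{X,CX,CCX,H\otimes H\}$ if and only if $V\in U_{2^n}(\mathbb{Z}[1/2])$. Moreover, if $n\ge 1$, a single clean ancilla always suffices: every $V\in U_{2^n}(\mathbb{Z}[1/2])$ is exactly represented by some circuit on $n+1$ qubits over $\{X,CX,CCX,H\otimes H\}$ using one clean ancilla. -/

import Mathlib

noncomputable section

namespace QCircuit

open scoped Kronecker

/-! ### Unitary matrices over the dyadic fractions -/

/-- The ring `ℤ[1/2]` of dyadic fractions `u / 2 ^ q` (`u` an integer, `q` a natural number),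
as a subring of `ℂ`. -/
def dyadic : Subring ℂ where
  carrier := {z | ∃ (u : ℤ) (q : ℕ), z = (u : ℂ) / 2 ^ q}
  zero_mem' := ⟨0, 0, by simp⟩
  one_mem' := ⟨1, 0, by simp⟩
  add_mem' := by
    rintro _ _ ⟨u, q, rfl⟩ ⟨v, r, rfl⟩
    refine ⟨u * 2 ^ r + v * 2 ^ q, q + r, ?_⟩
    push_cast
    rw [pow_add]
    field_simp
  mul_mem' := by
    rintro _ _ ⟨u, q, rfl⟩ ⟨v, r, rfl⟩
    refine ⟨u * v, q + r, ?_⟩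
    push_cast
    rw [pow_add]
    field_simp
  neg_mem' := by
    rintro _ ⟨u, q, rfl⟩
    refine ⟨-u, q, ?_⟩
    push_cast
    ring

/-- The unitary matrices with rows and columns indexed by `ι` and with all entries in the
subring `R` of `ℂ`. -/
def unitaryOver (ι : Type) [Fintype ι] [DecidableEq ι] (R : Subring ℂ) : Set (Matrix ι ι ℂ) :=
  {V | V ∈ Matrix.unitaryGroup ι ℂ ∧ ∀ i j, V i j ∈ R}

/-! ### Qubits and gates -/

/-- Bit strings of length `n`: the labels of the `2 ^ n` computational basis states of `n` qubits.
A `2 ^ n × 2 ^ n` matrix has its rows and columns indexed by `Bits n` (in block descriptions the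
strings are ordered lexicographically, the bit `0` being the most significant one). -/
abbrev Bits (n : ℕ) : Type := Fin n → Fin 2

/-- A gate: a number of qubits, and a matrix acting on that many qubits. -/
structure Gate where
  arity : ℕ
  mat : Matrix (Bits arity) (Bits arity) ℂ

/-- The `2 × 2` NOT matrix. -/
def matX : Matrix (Fin 2) (Fin 2) ℂ := !![0, 1; 1, 0]

/-- The `2 × 2` Hadamard matrix. -/
def matH : Matrix (Fin 2) (Fin 2) ℂ := ((1 / Real.sqrt 2 : ℝ) : ℂ) • !![1, 1; 1, -1]

/-- The controlled version `I ⊕ G` of a gate `G`; the control is qubit `0`. -/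
def Gate.ctrl (G : Gate) : Gate where
  arity := G.arity + 1
  mat := fun x y =>
    if x 0 = y 0 then
      if x 0 = 1 then G.mat (Fin.tail x) (Fin.tail y)
      else (1 : Matrix (Bits G.arity) (Bits G.arity) ℂ) (Fin.tail x) (Fin.tail y)
    else 0

/-- The one-qubit gate `X`. -/
def gateX : Gate where
  arity := 1
  mat := matX.submatrix (fun x => x 0) (fun x => x 0)

/-- The two-qubit gate `CX`. -/
def gateCX : Gate := gateX.ctrl

/-- The three-qubit Toffoli gate `CCX`. -/
def gateCCX : Gate := gateCX.ctrl

/-- The two-qubit gate `H ⊗ H`. -/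
def gateHH : Gate where
  arity := 2
  mat := (matH ⊗ₖ matH).submatrix (fun x => (x 0, x 1)) (fun x => (x 0, x 1))

/-- The gate set `{X, CX, CCX, H ⊗ H}`. -/
def integralGates : Set Gate := {gateX, gateCX, gateCCX, gateHH}

/-! ### Circuits -/

/-- The `N`-qubit operator that applies the gate `G` to the distinct qubits
`w 0, w 1, …` (in this order) and the identity to all other qubits. -/
def place (G : Gate) {N : ℕ} (w : Fin G.arity ↪ Fin N) : Matrix (Bits N) (Bits N) ℂ :=
  fun x y =>
    if ∀ i, (∀ k, w k ≠ i) → x i = y i then G.mat (fun k => x (w k)) (fun k => y (w k)) else 0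

/-- `N`-qubit circuits over the gate set `𝒢`: the empty circuit, a single gate of `𝒢` tensored with
the identity on the remaining wires (on any distinct wires), and the composite of two circuits.
Gates that act in parallel are obtained by composing gates on disjoint sets of wires. -/
inductive Circuit (𝒢 : Set Gate) (N : ℕ) : Type
  | id : Circuit 𝒢 N
  | gate (G : Gate) (hG : G ∈ 𝒢) (w : Fin G.arity ↪ Fin N) : Circuit 𝒢 N
  | comp (C D : Circuit 𝒢 N) : Circuit 𝒢 N

/-- The matrix of a circuit. -/
def Circuit.eval {𝒢 : Set Gate} {N : ℕ} : Circuit 𝒢 N → Matrix (Bits N) (Bits N) ℂ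
  | .id => 1
  | .gate G _ w => place G w
  | .comp C D => C.eval * D.eval

/-- Pure states of `n` qubits: the unit vectors of `ℂ ^ (2 ^ n)`. -/
def IsState {n : ℕ} (ψ : Bits n → ℂ) : Prop := ∑ x, ‖ψ x‖ ^ 2 = 1

/-- The vector `|ψ⟩|φ⟩` on `n + m` qubits. -/
def tensorVec {n m : ℕ} (ψ : Bits n → ℂ) (φ : Bits m → ℂ) : Bits (n + m) → ℂ :=
  fun x => ψ (fun i => x (Fin.castAdd m i)) * φ (fun j => x (Fin.natAdd n j))

/-- The state `|0⟩ ⊗ ⋯ ⊗ |0⟩` of `m` qubits. -/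
def ketZero (m : ℕ) : Bits m → ℂ := Pi.single (fun _ => 0) 1

/-- The matrix `V` is exactly represented by the circuit `D` using `m` clean ancillas:
`D |ψ⟩|0⟩^m = (V |ψ⟩)|0⟩^m` for every `n`-qubit state `|ψ⟩`. -/
def Represents {𝒢 : Set Gate} {n m : ℕ} (D : Circuit 𝒢 (n + m)) (V : Matrix (Bits n) (Bits n) ℂ) :
    Prop :=
  ∀ ψ : Bits n → ℂ, IsState ψ →
    D.eval.mulVec (tensorVec ψ (ketZero m)) = tensorVec (V.mulVec ψ) (ketZero m)

/-- `V` can be exactly represented by a circuit over `𝒢` using `m` clean ancillas. -/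
def RepresentableWith (𝒢 : Set Gate) {n : ℕ} (m : ℕ) (V : Matrix (Bits n) (Bits n) ℂ) : Prop :=
  ∃ D : Circuit 𝒢 (n + m), Represents D V

/-- `V` can be exactly represented by an `n`-qubit circuit over `𝒢`, where finitely many clean
ancillas may be used. -/
def Representable (𝒢 : Set Gate) {n : ℕ} (V : Matrix (Bits n) (Bits n) ℂ) : Prop :=
  ∃ m : ℕ, RepresentableWith 𝒢 m V

end QCircuit

end

noncomputable section

namespace QCircuit

open scoped Kronecker
open Matrix


/-! ### Reflections -/

section Refl

variable {ι : Type} [Fintype ι] [DecidableEq ι]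

/-! Necessity: every placed gate is unitary with dyadic entries, hence so is every circuit, and `V`
is its block with all ancillas equal to `0` (`mem_unitaryOver_of_represents`).

Sufficiency rests on reducing `V` to the identity column by column
(`mem_of_mem_unitaryOver_dyadic`). A column is `u / 2 ^ k` with integral `u` and `∑ u i ^ 2 = 4 ^
k`. For `k > 0` the number of odd `u i` is a multiple of 4. After at most one sign change, the
reflection `1 - w wᵀ / 2` in the sum `w` of four basis vectors makes four odd entries even; once all
entries are even, `k` drops. So sign changes, transpositions and these four-level reflections
suffice.

They are built as circuits for `A ⊗ 1` on `n + 1` wires (`liftable`). The extra wire serves as the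
borrowed wire for multiply controlled flips, which gives all permutations, and as the partner of a
lone Hadamard. Conjugating a transposition by `H` gives a sign change; conjugating that by `H ⊗ H`
gives a four-level reflection. -/

/-- The matrix `1 - c w wᵀ`. -/
def refl (c : ℂ) (w : ι → ℂ) : Matrix ι ι ℂ := 1 - c • vecMulVec w w

theorem refl_mulVec (c : ℂ) (w v : ι → ℂ) : refl c w *ᵥ v = v - (c * (w ⬝ᵥ v)) • w := by
  ext i
  simp [refl, Matrix.sub_mulVec, Matrix.smul_mulVec, vecMulVec_mulVec]
  ring

/-- Turns one available reflection into others. The plain transpose suffices because it is applied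
only to real matrices `U`. -/
theorem refl_conj (c : ℂ) (w : ι → ℂ) {U : Matrix ι ι ℂ} (hU : U * Uᵀ = 1) :
    U * refl c w * Uᵀ = refl c (U *ᵥ w) := by
  simp [refl, mul_sub, sub_mul, hU, mul_vecMulVec, vecMulVec_mul, vecMul_transpose]

omit [Fintype ι] in
theorem refl_smul (c a : ℂ) (w : ι → ℂ) : refl c (a • w) = refl (c * a ^ 2) w := by
  ext i j
  simp [refl, vecMulVec_apply]
  ring

theorem refl_mulVec_single_of_eq_zero (c : ℂ) {w : ι → ℂ} {t : ι} (h : w t = 0) :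
    refl c w *ᵥ Pi.single t 1 = Pi.single t 1 := by
  rw [refl_mulVec, dotProduct_single_one, h, mul_zero, zero_smul, sub_zero]

end Refl

/-! ### Exact synthesis over the dyadic fractions -/

section Synthesis

variable {ι : Type} [Fintype ι] [DecidableEq ι]

/-- The complex vector `u / 2 ^ k`. -/
def dyadicVec (u : ι → ℤ) (k : ℕ) : ι → ℂ := fun i => (u i : ℂ) / 2 ^ k

theorem refl_two_mulVec_dyadicVec (u : ι → ℤ) (k : ℕ) (i : ι) :
    refl 2 (Pi.single i 1) *ᵥ dyadicVec u k = dyadicVec (Function.update u i (-u i)) k := by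
  ext j
  rw [refl_mulVec]
  by_cases h : j = i
  · subst h
    simp [dyadicVec]
    ring
  · simp [dyadicVec, h]

/-- Half the sum of the four selected entries is subtracted from each of them; an even sum keeps the
numerators integral without raising `k`. -/
theorem refl_half_mulVec_dyadicVec (u : ι → ℤ) (k : ℕ) (f : Fin 4 ↪ ι) (s : ℤ)
    (hs : ∑ a, u (f a) = 2 * s) :
    refl (1 / 2) (∑ a, Pi.single (f a) 1) *ᵥ dyadicVec u k =
      dyadicVec (fun j => u j - if j ∈ Set.range f then s else 0) k := by
  classical
  have hs' : ∑ a, (u (f a) : ℂ) = 2 * s := by exact_mod_cast hs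
  have h1 : (∑ a, Pi.single (f a) 1 : ι → ℂ) ⬝ᵥ dyadicVec u k = 2 * s / 2 ^ k := by
    rw [sum_dotProduct, ← hs', Finset.sum_div]
    simp [dyadicVec]
  ext j
  rw [refl_mulVec, h1]
  have h2 : (∑ a, Pi.single (f a) 1 : ι → ℂ) j = if j ∈ Set.range f then 1 else 0 := by
    rw [Finset.sum_apply]
    split_ifs with h
    · obtain ⟨a, rfl⟩ := h
      simp [Pi.single_apply, f.injective.eq_iff]
    · apply Finset.sum_eq_zero
      intro a _
      rw [Pi.single_apply, if_neg]
      rintro rfl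
      exact h ⟨a, rfl⟩
  simp only [Pi.sub_apply, Pi.smul_apply, h2, dyadicVec, smul_eq_mul]
  split_ifs <;> push_cast <;> ring

omit [DecidableEq ι] in
-- Squares are `0` or `1` modulo 4 according to parity, so the sum of squares counts the odd entries
-- modulo 4.
theorem odd_card_dvd (u : ι → ℤ) (k : ℕ) (hu : ∑ i, u i ^ 2 = 4 ^ (k + 1)) :
    4 ∣ (Finset.univ.filter fun i => Odd (u i)).card := by
  have h : (∑ i, ((u i : ZMod 4)) ^ 2) = 0 := by
    have := congrArg (Int.cast : ℤ → ZMod 4) hu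
    push_cast at this
    rw [this, pow_succ]
    have : (4 : ZMod 4) = 0 := by decide
    rw [this, mul_zero]
  have h2 : ∀ i, ((u i : ZMod 4)) ^ 2 = if Odd (u i) then 1 else 0 := by
    intro i
    split_ifs with ho
    · obtain ⟨m, hm⟩ := ho
      rw [hm]
      push_cast
      generalize (m : ZMod 4) = z
      revert z
      decide
    · obtain ⟨m, hm⟩ := Int.not_odd_iff_even.mp ho
      rw [hm]
      push_cast
      generalize (m : ZMod 4) = z
      revert z
      decide
  simp only [h2, Finset.sum_boole] at h
  exact (ZMod.natCast_eq_zero_iff _ _).mp h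

theorem exists_single_of_sum_sq_eq_one (u : ι → ℤ) (hu : ∑ i, u i ^ 2 = 1) :
    ∃ i, (u i = 1 ∨ u i = -1) ∧ ∀ j, j ≠ i → u j = 0 := by
  obtain ⟨i, hi⟩ : ∃ i, u i ≠ 0 := by
    by_contra! h
    simp [h] at hu
  have h1 : 1 ≤ u i ^ 2 := by have := sq_pos_of_ne_zero hi; omega
  have h2 := Finset.add_sum_erase Finset.univ (fun i => u i ^ 2) (Finset.mem_univ i)
  have h3 : 0 ≤ ∑ x ∈ Finset.univ.erase i, u x ^ 2 := Finset.sum_nonneg fun x _ => sq_nonneg _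
  refine ⟨i, sq_eq_sq_iff_eq_or_eq_neg.mp (by omega), fun j hj => ?_⟩
  have h4 := (Finset.sum_eq_zero_iff_of_nonneg (fun x _ => sq_nonneg (u x))).mp
    (by omega : ∑ x ∈ Finset.univ.erase i, u x ^ 2 = 0) j (by simp [hj])
  exact pow_eq_zero_iff two_ne_zero |>.mp h4

theorem unitaryOver_mul {R : Subring ℂ}
    {A B : Matrix ι ι ℂ} (hA : A ∈ unitaryOver ι R) (hB : B ∈ unitaryOver ι R) :
    A * B ∈ unitaryOver ι R := by
  refine ⟨mul_mem hA.1 hB.1, fun i j => ?_⟩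
  rw [mul_apply]
  exact sum_mem fun x _ => mul_mem (hA.2 i x) (hB.2 x j)

variable (M : Submonoid (Matrix ι ι ℂ))

/-- The submonoid of the elements of `M` that fix the basis vectors with index in `T`. -/
def fixing (T : Set ι) : Submonoid (Matrix ι ι ℂ) where
  carrier := {g | g ∈ M ∧ ∀ t ∈ T, g *ᵥ Pi.single t 1 = Pi.single t 1}
  one_mem' := ⟨M.one_mem, fun _ _ => one_mulVec _⟩
  mul_mem' := by
    rintro a b ⟨ha, ha'⟩ ⟨hb, hb'⟩
    refine ⟨M.mul_mem ha hb, fun t ht => ?_⟩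
    rw [← mulVec_mulVec, hb' t ht, ha' t ht]

variable {M}

/-- Lexicographic descent on the exponent `k` and then on a bound `c` for the number of odd
numerators. `T` holds the columns already finished; every reflection used is supported off `T`,
where alone `u` can be nonzero. -/
theorem exists_fixing_mulVec_eq_single
    (h1 : ∀ i, refl 2 (Pi.single i 1) ∈ M)
    (h4 : ∀ f : Fin 4 ↪ ι, refl (1 / 2) (∑ a, Pi.single (f a) 1) ∈ M) (T : Set ι) (k : ℕ) :
    ∀ (c : ℕ) (u : ι → ℤ), (Finset.univ.filter fun i => Odd (u i)).card ≤ c →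
      ∑ i, u i ^ 2 = 4 ^ k → (∀ t ∈ T, u t = 0) →
      ∃ g ∈ fixing M T, ∃ j ∉ T, g *ᵥ dyadicVec u k = Pi.single j 1 := by
  have hflip : ∀ i ∉ T, refl 2 (Pi.single i 1) ∈ fixing M T := fun i hi =>
    ⟨h1 i, fun t ht => refl_mulVec_single_of_eq_zero _
      (Pi.single_eq_of_ne (fun h : t = i => hi (h ▸ ht)) _)⟩
  have hfour : ∀ f : Fin 4 ↪ ι, (∀ a, f a ∉ T) →
      refl (1 / 2) (∑ a, Pi.single (f a) 1) ∈ fixing M T := fun f hf =>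
    ⟨h4 f, fun t ht => refl_mulVec_single_of_eq_zero _ (by
      rw [Finset.sum_apply]
      exact Finset.sum_eq_zero fun a _ => Pi.single_eq_of_ne (fun h : t = f a => hf a (h ▸ ht)) _)⟩
  induction k with
  | zero =>
    intro c u _ hu hT
    obtain ⟨i, hi, hj⟩ := exists_single_of_sum_sq_eq_one u (by simpa using hu)
    have hiT : i ∉ T := fun h => by simp [hT i h] at hi
    have key : ∀ u : ι → ℤ, u i = 1 → (∀ j, j ≠ i → u j = 0) →
        dyadicVec u 0 = Pi.single i 1 := by
      intro u hi hj
      ext j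
      by_cases h : j = i
      · subst h; simp [dyadicVec, hi]
      · simp [dyadicVec, h, hj j h]
    rcases hi with hi | hi
    · exact ⟨1, one_mem _, i, hiT, by rw [one_mulVec, key u hi hj]⟩
    · refine ⟨_, hflip i hiT, i, hiT, ?_⟩
      rw [refl_two_mulVec_dyadicVec]
      exact key _ (by simp [hi]) (fun j h => by simp [h, hj j h])
  | succ k ih =>
    intro c
    induction c with
    | zero =>
      intro u hc hu hT
      have he : ∀ i, ∃ v, u i = 2 * v := fun i => by
        have : ¬ Odd (u i) := fun h => by
          have : i ∈ (Finset.univ.filter fun i => Odd (u i)) := by simp [h]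
          rw [Finset.card_eq_zero.mp (Nat.le_zero.mp hc)] at this
          simp at this
        obtain ⟨v, hv⟩ := Int.not_odd_iff_even.mp this
        exact ⟨v, by omega⟩
      choose v hv using he
      have hvec : dyadicVec u (k + 1) = dyadicVec v k := by
        ext i
        simp only [dyadicVec, hv i, pow_succ]
        push_cast
        field_simp
      rw [hvec]
      -- All numerators were even, so one factor 2 cancels; the odd count of `v` is unrestricted,
      -- which is why `c` is quantified inside the induction on `k`.
      refine ih _ v le_rfl ?_ (fun t ht => ?_)
      · have : ∑ i, u i ^ 2 = 4 * ∑ i, v i ^ 2 := by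
          rw [Finset.mul_sum]
          exact Finset.sum_congr rfl fun i _ => by rw [hv i]; ring
        rw [this, pow_succ] at hu
        omega
      · have := hT t ht
        have := hv t
        omega
    | succ c ihc =>
      intro u hc hu hT
      have hdvd := odd_card_dvd u k hu
      by_cases h0 : (Finset.univ.filter fun i => Odd (u i)).card = 0
      · exact ihc u (by omega) hu hT
      have hge : 4 ≤ (Finset.univ.filter fun i => Odd (u i)).card := by omega
      obtain ⟨f, hf⟩ : ∃ f : Fin 4 ↪ ι, ∀ a, Odd (u (f a)) := by
        obtain ⟨e⟩ : Nonempty (Fin 4 ↪ (Finset.univ.filter fun i => Odd (u i))) :=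
          Function.Embedding.nonempty_of_card_le (by rwa [Fintype.card_fin, Fintype.card_coe])
        refine ⟨e.trans (Function.Embedding.subtype _), fun a => ?_⟩
        exact (Finset.mem_filter.mp (e a).2).2
      have hfT : ∀ a, f a ∉ T := fun a h => by simpa [hT _ h] using hf a
      -- If the four odd entries sum to 2 modulo 4, the half-sum `s` is odd, so subtracting it makes
      -- all four even and leaves the other entries alone.
      have main : ∀ u : ι → ℤ, (Finset.univ.filter fun i => Odd (u i)).card ≤ c + 1 →
          ∑ i, u i ^ 2 = 4 ^ (k + 1) → (∀ t ∈ T, u t = 0) → (∀ a, Odd (u (f a))) →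
          (∑ a, u (f a)) % 4 = 2 →
          ∃ g ∈ fixing M T, ∃ j ∉ T, g *ᵥ dyadicVec u (k + 1) = Pi.single j 1 := by
        intro u hc hu hT hf hmod
        obtain ⟨s, hs, hodd⟩ : ∃ s, ∑ a, u (f a) = 2 * s ∧ Odd s :=
          ⟨(∑ a, u (f a)) / 2, by omega, by rw [Int.odd_iff]; omega⟩
        classical
        set u' : ι → ℤ := fun j => u j - if j ∈ Set.range f then s else 0 with hu'
        suffices H : (Finset.univ.filter fun i => Odd (u' i)).card ≤ c ∧
            ∑ i, u' i ^ 2 = 4 ^ (k + 1) ∧ ∀ t ∈ T, u' t = 0 by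
          obtain ⟨g, hg, j, hj, h⟩ := ihc u' H.1 H.2.1 H.2.2
          refine ⟨g * _, mul_mem hg (hfour f hfT), j, hj, ?_⟩
          rw [← mulVec_mulVec, refl_half_mulVec_dyadicVec u (k + 1) f s hs]
          exact h
        refine ⟨?_, ?_, ?_⟩
        · have hsub : (Finset.univ.filter fun i => Odd (u' i)) ⊂
              (Finset.univ.filter fun i => Odd (u i)) := by
            rw [Finset.ssubset_iff_of_subset]
            · refine ⟨f 0, by simp [hf], ?_⟩
              simp [hu', Int.odd_sub, hf, hodd]
            · intro i
              simp only [Finset.mem_filter, Finset.mem_univ, true_and, hu']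
              split_ifs with h
              · obtain ⟨a, rfl⟩ := h
                exact fun _ => hf a
              · simp
          have := Finset.card_lt_card hsub
          omega
        -- The norm is preserved because the four corrections total `4 * s ^ 2 - 2 * s * (2 * s) =
        -- 0`.
        · have hsplit : ∀ i, u' i ^ 2 = u i ^ 2 +
              ∑ a, if i = f a then (s ^ 2 - 2 * s * u i) else 0 := by
            intro i
            simp only [hu']
            split_ifs with h
            · obtain ⟨a, rfl⟩ := h
              simp [f.injective.eq_iff]
              ring
            · rw [Finset.sum_eq_zero]
              · ring
              · intro a _
                rw [if_neg]
                rintro rfl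
                exact h ⟨a, rfl⟩
          rw [Finset.sum_congr rfl fun i _ => hsplit i, Finset.sum_add_distrib, hu,
            Finset.sum_comm]
          simp only [Finset.sum_ite_eq', Finset.mem_univ, if_true, Finset.sum_sub_distrib,
            ← Finset.mul_sum, hs]
          simp
          ring
        · intro t ht
          have : t ∉ Set.range f := by
            rintro ⟨a, rfl⟩
            exact hfT a ht
          simp only [hu', if_neg this, hT t ht, sub_zero]
      -- Four odd numbers sum to 0 or 2 modulo 4, and negating one of them exchanges the two cases.
      by_cases hmod : (∑ a, u (f a)) % 4 = 2
      · exact main u hc hu hT hf hmod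
      · have hpar : ∀ i, Odd (Function.update u (f 0) (-u (f 0)) i) ↔ Odd (u i) := by
          intro i
          by_cases h : i = f 0
          · subst h; simp
          · simp [h]
        set u' := Function.update u (f 0) (-u (f 0)) with hu'
        suffices H : (Finset.univ.filter fun i => Odd (u' i)).card ≤ c + 1 ∧
            ∑ i, u' i ^ 2 = 4 ^ (k + 1) ∧ (∀ t ∈ T, u' t = 0) ∧ (∀ a, Odd (u' (f a))) ∧
            (∑ a, u' (f a)) % 4 = 2 by
          obtain ⟨g, hg, j, hj, h⟩ := main u' H.1 H.2.1 H.2.2.1 H.2.2.2.1 H.2.2.2.2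
          refine ⟨g * _, mul_mem hg (hflip (f 0) (hfT 0)), j, hj, ?_⟩
          rw [← mulVec_mulVec, refl_two_mulVec_dyadicVec]
          exact h
        simp only [hu']
        refine ⟨?_, ?_, ?_, ?_, ?_⟩
        · rwa [Finset.filter_congr fun i _ => hpar i]
        · rw [← hu]
          refine Finset.sum_congr rfl fun i _ => ?_
          by_cases h : i = f 0
          · subst h; simp
          · simp [h]
        · intro t ht
          have : t ≠ f 0 := fun h => hfT 0 (h ▸ ht)
          simp [this, hT t ht]
        · intro a
          rw [hpar]
          exact hf a
        · have h0 := hf 0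
          have h1 := hf 1
          have h2 := hf 2
          have h3 := hf 3
          rw [Int.odd_iff] at h0 h1 h2 h3
          simp only [Fin.sum_univ_four, Function.update_self, ne_eq, f.injective.eq_iff,
            Fin.reduceEq, not_false_eq_true, Function.update_of_ne] at hmod ⊢
          omega

omit [DecidableEq ι] in
theorem exists_dyadicVec (v : ι → ℂ) (hv : ∀ i, v i ∈ dyadic) :
    ∃ (u : ι → ℤ) (k : ℕ), v = dyadicVec u k := by
  choose u q h using hv
  refine ⟨fun i => u i * 2 ^ (∑ j, q j - q i), ∑ j, q j, ?_⟩
  ext i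
  have hle : q i ≤ ∑ j, q j := Finset.single_le_sum (fun _ _ => Nat.zero_le _) (Finset.mem_univ i)
  simp only [dyadicVec, h i]
  push_cast
  rw [div_eq_div_iff (pow_ne_zero _ two_ne_zero) (pow_ne_zero _ two_ne_zero), mul_assoc, ← pow_add,
    Nat.sub_add_cancel hle]

/-- Induction on the number of basis vectors not yet fixed. One more column is cleared by an element
of `M`, which is then undone by its adjoint. -/
theorem mem_of_mem_unitaryOver_dyadic
    (hunit : ∀ g ∈ M, g ∈ unitaryOver ι dyadic) (hstar : ∀ g ∈ M, gᴴ ∈ M)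
    (h1 : ∀ i, refl 2 (Pi.single i 1) ∈ M)
    (h2 : ∀ i j, i ≠ j → refl 1 (Pi.single i 1 - Pi.single j 1) ∈ M)
    (h4 : ∀ f : Fin 4 ↪ ι, refl (1 / 2) (∑ a, Pi.single (f a) 1) ∈ M)
    {V : Matrix ι ι ℂ} (hV : V ∈ unitaryOver ι dyadic) : V ∈ M := by
  suffices H : ∀ (c : ℕ) (T : Finset ι), Tᶜ.card = c → ∀ V ∈ unitaryOver ι dyadic,
      (∀ t ∈ T, V *ᵥ Pi.single t 1 = Pi.single t 1) → V ∈ M from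
    H _ ∅ rfl V hV (by simp)
  intro c
  induction c with
  | zero =>
    intro T hT V _ hfix
    have hT' : T = Finset.univ := by simpa using hT
    have : V = 1 := by
      refine ext_of_mulVec_single fun i => ?_
      rw [hfix i (by simp [hT']), one_mulVec]
    rw [this]
    exact one_mem _
  | succ c ih =>
    intro T hT V hV hfix
    obtain ⟨j, hj⟩ : ∃ j, j ∈ Tᶜ := Finset.card_pos.mp (by omega)
    have hjT : j ∉ T := by simpa using hj
    obtain ⟨u, k, huk⟩ := exists_dyadicVec (fun i => V i j) (fun i => hV.2 i j)
    have hVV : Vᴴ * V = 1 := by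
      have := (mem_unitaryGroup_iff').mp hV.1
      rwa [star_eq_conjTranspose] at this
    have hcol : ∀ i, V i j = (u i : ℂ) / 2 ^ k := fun i => congrFun huk i
    have hsq : ∑ i, u i ^ 2 = 4 ^ k := by
      have h := congrFun (congrFun hVV j) j
      simp only [mul_apply, conjTranspose_apply, one_apply_eq, hcol, star_div₀, star_pow,
        star_intCast, star_ofNat] at h
      have h' : ∑ i, ((u i : ℂ)) ^ 2 = 4 ^ k := by
        have e : ∀ i, (u i : ℂ) / 2 ^ k * ((u i : ℂ) / 2 ^ k) = (u i : ℂ) ^ 2 / 4 ^ k := by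
          intro i
          rw [div_mul_div_comm, ← mul_pow, ← sq]
          norm_num
        simp only [e, ← Finset.sum_div] at h
        rwa [div_eq_one_iff_eq (by simp)] at h
      exact_mod_cast h'
    -- Column `j` is orthogonal to the columns in `T`, which are basis vectors.
    have hzero : ∀ t ∈ (T : Set ι), u t = 0 := by
      intro t ht
      have h := congrFun (congrFun hVV t) j
      have htj : t ≠ j := fun e => hjT (e ▸ ht)
      have hcolt : ∀ i, V i t = if i = t then 1 else 0 := fun i => by
        have := congrFun (hfix t ht) i
        simpa [Pi.single_apply] using this
      simp only [mul_apply, conjTranspose_apply, one_apply_ne htj, hcolt, hcol] at h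
      simpa using h
    obtain ⟨g, ⟨hg, hgfix⟩, i, hi, hgi⟩ :=
      exists_fixing_mulVec_eq_single h1 h4 (T : Set ι) k _ u le_rfl hsq hzero
    -- The reduction leaves its `1` at an uncontrolled index `i` outside `T`; a transposition brings
    -- it to `j`.
    obtain ⟨s, hs, hsfix, hsi⟩ : ∃ s ∈ M, (∀ t ∈ T, s *ᵥ Pi.single t 1 = Pi.single t 1) ∧
        s *ᵥ Pi.single i 1 = Pi.single j 1 := by
      by_cases hij : i = j
      · exact ⟨1, one_mem _, fun _ _ => one_mulVec _, by rw [one_mulVec, hij]⟩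
      · refine ⟨_, h2 i j hij, fun t ht => refl_mulVec_single_of_eq_zero _ ?_, ?_⟩
        · have a : t ≠ i := fun e => hi (e ▸ ht)
          have b : t ≠ j := fun e => hjT (e ▸ ht)
          simp [a, b]
        · rw [refl_mulVec, dotProduct_single_one]
          simp [hij]
    have hsg : s * g ∈ M := mul_mem hs hg
    have hmem : s * g * V ∈ M := by
      refine ih (insert j T) ?_ _ (unitaryOver_mul (hunit _ hsg) hV) ?_
      · rw [Finset.compl_insert, Finset.card_erase_of_mem hj, hT]
        rfl
      · intro t ht
        rw [← mulVec_mulVec, ← mulVec_mulVec]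
        rcases Finset.mem_insert.mp ht with rfl | ht
        · have : V *ᵥ Pi.single t 1 = dyadicVec u k := by
            rw [← huk]
            ext i
            simp
          rw [this, hgi, hsi]
        · rw [hfix t ht, hgfix t ht, hsfix t ht]
    have hinv : (s * g)ᴴ * (s * g) = 1 := by
      have := (mem_unitaryGroup_iff').mp (hunit _ hsg).1
      rwa [star_eq_conjTranspose] at this
    have := mul_mem (hstar _ hsg) hmem
    rwa [← mul_assoc, hinv, one_mul] at this

end Synthesis


/-! ### Placing matrices on wires -/

/-- The matrix `A` applied to the wires `w`, the identity on the other wires. -/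
def placeMat {k N : ℕ} (A : Matrix (Bits k) (Bits k) ℂ) (w : Fin k ↪ Fin N) :
    Matrix (Bits N) (Bits N) ℂ :=
  fun x y => if ∀ i, (∀ a, w a ≠ i) → x i = y i then A (fun a => x (w a)) (fun a => y (w a)) else 0

theorem place_eq_placeMat (G : Gate) {N : ℕ} (w : Fin G.arity ↪ Fin N) :
    place G w = placeMat G.mat w := rfl

/-- Splitting a bit string into the bits on the wires `w` and the other bits. -/
def splitWires {k N : ℕ} (w : Fin k ↪ Fin N) :
    Bits N ≃ Bits k × ({i : Fin N // ∀ a, w a ≠ i} → Fin 2) where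
  toFun x := (fun a => x (w a), fun i => x i)
  invFun p i := if h : ∃ a, w a = i then p.1 h.choose else p.2 ⟨i, by simpa using h⟩
  left_inv x := by
    ext i
    dsimp only
    split_ifs with h
    · rw [h.choose_spec]
    · rfl
  right_inv p := by
    refine Prod.ext ?_ ?_
    · ext a
      have h : ∃ b, w b = w a := ⟨a, rfl⟩
      simp only [dif_pos h, w.injective h.choose_spec]
    · ext ⟨i, hi⟩
      have h : ¬ ∃ b, w b = i := by simpa using hi
      simp only [dif_neg h]

theorem placeMat_eq_submatrix {k N : ℕ} (A : Matrix (Bits k) (Bits k) ℂ) (w : Fin k ↪ Fin N) :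
    placeMat A w = (A ⊗ₖ (1 : Matrix ({i : Fin N // ∀ a, w a ≠ i} → Fin 2) _ ℂ)).submatrix
      (splitWires w) (splitWires w) := by
  ext x y
  simp [placeMat, splitWires, kroneckerMap_apply, Matrix.one_apply, funext_iff]

theorem placeMat_mul {k N : ℕ} (A B : Matrix (Bits k) (Bits k) ℂ) (w : Fin k ↪ Fin N) :
    placeMat A w * placeMat B w = placeMat (A * B) w := by
  rw [placeMat_eq_submatrix, placeMat_eq_submatrix, placeMat_eq_submatrix, submatrix_mul_equiv,
    ← mul_kronecker_mul, one_mul]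

theorem placeMat_one {k N : ℕ} (w : Fin k ↪ Fin N) :
    placeMat (1 : Matrix (Bits k) (Bits k) ℂ) w = 1 := by
  rw [placeMat_eq_submatrix, one_kronecker_one, submatrix_one_equiv]

theorem placeMat_transpose {k N : ℕ} (A : Matrix (Bits k) (Bits k) ℂ) (w : Fin k ↪ Fin N) :
    (placeMat A w)ᵀ = placeMat Aᵀ w := by
  ext x y
  simp only [transpose_apply, placeMat, eq_comm]

theorem placeMat_conjTranspose {k N : ℕ} (A : Matrix (Bits k) (Bits k) ℂ) (w : Fin k ↪ Fin N) :
    (placeMat A w)ᴴ = placeMat Aᴴ w := by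
  ext x y
  simp only [conjTranspose_apply, placeMat, eq_comm]
  split_ifs <;> simp

/-! ### Matrices of functions -/

section FunMat

variable {α : Type} [Fintype α] [DecidableEq α]

/-- The `0`-`1` matrix that maps the basis vector `y` to the basis vector `f y`. -/
def funMat (f : α → α) : Matrix α α ℂ := fun x y => if x = f y then 1 else 0

omit [Fintype α] in
theorem funMat_id : funMat (id : α → α) = 1 := by
  ext x y
  simp [funMat, Matrix.one_apply]

theorem funMat_mul (f g : α → α) : funMat f * funMat g = funMat (f ∘ g) := by
  ext x y
  simp [funMat, mul_apply]

omit [Fintype α] in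
theorem funMat_transpose (σ : Equiv.Perm α) : (funMat σ)ᵀ = funMat ⇑σ⁻¹ := by
  ext x y
  simp only [funMat, transpose_apply, Equiv.Perm.eq_inv_iff_eq, eq_comm]

omit [Fintype α] in
theorem funMat_conjTranspose (σ : Equiv.Perm α) : (funMat σ)ᴴ = funMat ⇑σ⁻¹ := by
  rw [← funMat_transpose]
  ext x y
  simp only [funMat, conjTranspose_apply, transpose_apply]
  split_ifs <;> simp

theorem funMat_mul_transpose (σ : Equiv.Perm α) : funMat σ * (funMat σ)ᵀ = 1 := by
  rw [funMat_transpose, funMat_mul, ← Equiv.Perm.coe_mul, mul_inv_cancel, Equiv.Perm.coe_one,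
    funMat_id]

theorem funMat_mulVec_single (f : α → α) (x : α) :
    funMat f *ᵥ Pi.single x 1 = Pi.single (f x) 1 := by
  ext y
  simp [funMat, Pi.single_apply]

theorem funMat_swap {p q : α} (h : p ≠ q) :
    funMat (Equiv.swap p q) = refl 1 (Pi.single p 1 - Pi.single q 1) := by
  refine ext_of_mulVec_single fun x => ?_
  rw [funMat_mulVec_single, refl_mulVec, dotProduct_single_one]
  by_cases hp : x = p
  · subst hp
    simp [h]
  by_cases hq : x = q
  · subst hq
    simp [h.symm]
  · simp [hp, hq, Equiv.swap_apply_of_ne_of_ne hp hq]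

end FunMat

/-! ### Controlled bit flips -/

/-- Flip the bit `t` if all the bits in `S` are `1`. -/
def cflip {N : ℕ} (S : Finset (Fin N)) (t : Fin N) (x : Bits N) : Bits N :=
  if ∀ s ∈ S, x s = 1 then Function.update x t (x t + 1) else x

theorem fin_two_add_one_add_one (b : Fin 2) : b + 1 + 1 = b := by
  revert b
  decide

/-- A commutator of two involutions. The wire `a` is toggled by `S` and later restored, and `t` is
flipped once for each value of `a`, under control of `T`. Nothing is assumed about the initial bit
at `a`, so it can be borrowed. -/
theorem cflip_union {N : ℕ} (S T : Finset (Fin N)) {a t : Fin N} (hat : a ≠ t)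
    (haS : a ∉ S) (htS : t ∉ S) (haT : a ∉ T) (htT : t ∉ T) :
    (cflip (insert a T) t ∘ cflip S a) ∘ (cflip (insert a T) t ∘ cflip S a) =
      cflip (S ∪ T) t := by
  have hS : ∀ (x : Bits N) (b c : Fin 2),
      (∀ s ∈ S, Function.update (Function.update x a b) t c s = 1) ↔ ∀ s ∈ S, x s = 1 := by
    intro x b c
    refine forall₂_congr fun s hs => ?_
    rw [Function.update_of_ne (fun h : s = t => htS (h ▸ hs)),
      Function.update_of_ne (fun h : s = a => haS (h ▸ hs))]
  have hT : ∀ (x : Bits N) (b c : Fin 2),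
      (∀ s ∈ T, Function.update (Function.update x a b) t c s = 1) ↔ ∀ s ∈ T, x s = 1 := by
    intro x b c
    refine forall₂_congr fun s hs => ?_
    rw [Function.update_of_ne (fun h : s = t => htT (h ▸ hs)),
      Function.update_of_ne (fun h : s = a => haT (h ▸ hs))]
  -- Only the bits at `a` and `t` ever change, so the composite is followed through the pair `(b,
  -- c)`.
  have key : ∀ (x : Bits N) (b c : Fin 2), cflip S a (Function.update (Function.update x a b) t c) =
      Function.update (Function.update x a (if ∀ s ∈ S, x s = 1 then b + 1 else b)) t c := by
    intro x b c
    rw [cflip, if_congr (hS x b c) rfl rfl]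
    split_ifs
    · rw [Function.update_of_ne hat, Function.update_self, Function.update_comm hat.symm,
        Function.update_idem]
    · rfl
  have key' : ∀ (x : Bits N) (b c : Fin 2),
      cflip (insert a T) t (Function.update (Function.update x a b) t c) =
      Function.update (Function.update x a b) t
        (if b = 1 ∧ ∀ s ∈ T, x s = 1 then c + 1 else c) := by
    intro x b c
    have h : (∀ s ∈ insert a T, Function.update (Function.update x a b) t c s = 1) ↔
        b = 1 ∧ ∀ s ∈ T, x s = 1 := by
      rw [Finset.forall_mem_insert, Function.update_of_ne hat, Function.update_self, hT]
    rw [cflip, if_congr h rfl rfl]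
    split_ifs
    · rw [Function.update_self, Function.update_idem]
    · rfl
  funext x
  have hx : x = Function.update (Function.update x a (x a)) t (x t) := by simp
  have hu : ∀ c, Function.update x t c = Function.update (Function.update x a (x a)) t c := by simp
  have hun : (∀ s ∈ S ∪ T, x s = 1) ↔ (∀ s ∈ S, x s = 1) ∧ ∀ s ∈ T, x s = 1 := by
    simp only [Finset.mem_union, or_imp, forall_and]
  have hR : cflip (S ∪ T) t x = Function.update (Function.update x a (x a)) t
      (if (∀ s ∈ S, x s = 1) ∧ ∀ s ∈ T, x s = 1 then x t + 1 else x t) := by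
    rw [cflip, if_congr hun rfl rfl]
    split_ifs
    · exact hu _
    · exact hx
  rw [hR]
  simp only [Function.comp_apply]
  conv_lhs => rw [hx]
  simp only [key, key']
  rcases Classical.propComplete (∀ s ∈ S, x s = 1) with h1 | h1 <;>
    rcases Classical.propComplete (∀ s ∈ T, x s = 1) with h2 | h2 <;>
    simp only [h1, h2, and_true, and_false, if_true, if_false, fin_two_add_one_add_one]
  -- Both control conditions hold: `a` carries `b + 1` and then `b`, exactly one of which is `1`, so
  -- `t` flips once.
  · generalize x a = b
    generalize x t = c
    congr 1
    revert b c
    decide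
  · split_ifs
    · rw [fin_two_add_one_add_one]
    · rfl

theorem placeMat_funMat_cflip {k N : ℕ} (S : Finset (Fin k)) (t : Fin k) (w : Fin k ↪ Fin N) :
    placeMat (funMat (cflip S t)) w = funMat (cflip (S.map w) (w t)) := by
  ext x y
  have hS : (∀ s ∈ S.map w, y s = 1) ↔ ∀ s ∈ S, y (w s) = 1 := by simp
  simp only [placeMat, funMat, ← ite_and]
  refine if_congr ?_ rfl rfl
  rw [cflip, cflip, if_congr hS rfl rfl]
  by_cases h : ∀ s ∈ S, y (w s) = 1
  · rw [if_pos h, if_pos h]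
    constructor
    · rintro ⟨h1, h2⟩
      funext i
      by_cases hi : ∃ a, w a = i
      · obtain ⟨a, rfl⟩ := hi
        have := congrFun h2 a
        by_cases hat : a = t
        · subst hat
          simpa using this
        · simpa [hat] using this
      · push Not at hi
        rw [h1 i hi, Function.update_of_ne (hi t).symm]
    · rintro rfl
      refine ⟨fun i hi => by rw [Function.update_of_ne (hi t).symm], ?_⟩
      funext a
      by_cases hat : a = t
      · subst hat
        simp
      · simp [hat]
  · rw [if_neg h, if_neg h]
    constructor
    · rintro ⟨h1, h2⟩
      funext i
      by_cases hi : ∃ a, w a = i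
      · obtain ⟨a, rfl⟩ := hi
        exact congrFun h2 a
      · push Not at hi
        exact h1 i hi
    · rintro rfl
      simp

/-! ### The matrices of the gates -/

theorem gateX_mat : gateX.mat = funMat (cflip ∅ (0 : Fin 1)) := by
  refine Matrix.ext fun (x y : Bits 1) => ?_
  have : x = Function.update y 0 (y 0 + 1) ↔ x 0 = y 0 + 1 := by
    simp [funext_iff, Fin.forall_fin_one]
  have h2 : gateX.mat x y = matX (x 0) (y 0) := rfl
  simp only [funMat, cflip, Finset.notMem_empty, false_imp_iff, implies_true, if_true, h2]
  rw [if_congr this rfl rfl, matX]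
  generalize x 0 = a
  generalize y 0 = b
  fin_cases a <;> fin_cases b <;> simp

theorem Gate.ctrl_mat {G : Gate} {S : Finset (Fin G.arity)} {t : Fin G.arity}
    (h : G.mat = funMat (cflip S t)) :
    G.ctrl.mat = funMat (cflip (insert 0 (S.map (Fin.succEmb _))) t.succ) := by
  refine Matrix.ext fun (x y : Bits (G.arity + 1)) => ?_
  have h2 : G.ctrl.mat x y = if x 0 = y 0 then
      if x 0 = 1 then G.mat (Fin.tail x) (Fin.tail y)
      else (1 : Matrix (Bits G.arity) (Bits G.arity) ℂ) (Fin.tail x) (Fin.tail y)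
    else 0 := rfl
  rw [h2, h]
  obtain ⟨a, x, rfl⟩ : ∃ a x', x = Fin.cons a x' := ⟨x 0, Fin.tail x, (Fin.cons_self_tail x).symm⟩
  obtain ⟨b, y, rfl⟩ : ∃ b y', y = Fin.cons b y' := ⟨y 0, Fin.tail y, (Fin.cons_self_tail y).symm⟩
  have h3 : cflip (insert 0 (S.map (Fin.succEmb _))) t.succ (Fin.cons b y : Bits (G.arity + 1)) =
      Fin.cons b (if b = 1 then cflip S t y else y) := by
    simp only [cflip, Finset.forall_mem_insert, Fin.cons_zero, Finset.forall_mem_map,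
      Fin.coe_succEmb, Fin.cons_succ, ite_and]
    split_ifs
    · rw [Fin.cons_update]
    · rfl
    · rfl
  simp only [funMat]
  have h4 : (Fin.cons a x : Bits (G.arity + 1)) =
      cflip (insert 0 (S.map (Fin.succEmb _))) t.succ (Fin.cons b y : Bits (G.arity + 1)) ↔
      a = b ∧ x = if b = 1 then cflip S t y else y := by
    rw [h3]
    exact Fin.cons_inj
  rw [if_congr h4 rfl rfl]
  simp only [Fin.cons_zero, Fin.tail_cons, Matrix.one_apply]
  by_cases hab : a = b
  · subst hab
    by_cases ha : a = 1 <;> simp [ha]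
  · simp [hab]

theorem gateCX_mat : gateCX.mat = funMat (cflip {0} (1 : Fin 2)) :=
  Gate.ctrl_mat gateX_mat

theorem gateCCX_mat : gateCCX.mat = funMat (cflip {0, 1} (2 : Fin 3)) :=
  Gate.ctrl_mat (G := gateCX) gateCX_mat

theorem matH_apply (a b : Fin 2) :
    matH a b = ((1 / Real.sqrt 2 : ℝ) : ℂ) * if a = 1 ∧ b = 1 then -1 else 1 := by
  rw [matH, Matrix.smul_apply, smul_eq_mul]
  fin_cases a <;> fin_cases b <;> simp

/-- The reason for using `H` in pairs: `H ⊗ H` has entries `±1/2`, which are dyadic. -/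
theorem inv_sqrt_two_mul_self :
    ((1 / Real.sqrt 2 : ℝ) : ℂ) * ((1 / Real.sqrt 2 : ℝ) : ℂ) = 1 / 2 := by
  rw [← Complex.ofReal_mul, div_mul_div_comm, Real.mul_self_sqrt (by norm_num)]
  norm_num

theorem matH_mul_matH : matH * matH = 1 := by
  ext a b
  simp only [mul_apply, matH_apply, Fin.sum_univ_two]
  have h := inv_sqrt_two_mul_self
  generalize ((1 / Real.sqrt 2 : ℝ) : ℂ) = r at h
  fin_cases a <;> fin_cases b <;> simp <;> linear_combination 2 * h

theorem matH_transpose : matHᵀ = matH := by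
  ext a b
  simp only [transpose_apply, matH_apply, and_comm]

/-- The matrix of the gate `H ⊗ H`. -/
def matHH : Matrix (Bits 2) (Bits 2) ℂ := gateHH.mat

theorem matHH_eq_matH_mul_matH (x y : Bits 2) :
    matHH x y = matH (x 0) (y 0) * matH (x 1) (y 1) := rfl

theorem matHH_apply (x y : Bits 2) : matHH x y =
    1 / 2 * ((if x 0 = 1 ∧ y 0 = 1 then -1 else 1) * if x 1 = 1 ∧ y 1 = 1 then -1 else 1) := by
  rw [matHH_eq_matH_mul_matH, matH_apply, matH_apply, ← inv_sqrt_two_mul_self]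
  ring

theorem matHH_mul_matHH : matHH * matHH = 1 := by
  have h : matHH = (matH ⊗ₖ matH).submatrix (finTwoArrowEquiv (Fin 2))
    (finTwoArrowEquiv (Fin 2)) := rfl
  rw [h, submatrix_mul_equiv, ← mul_kronecker_mul, matH_mul_matH, one_kronecker_one]
  exact submatrix_one_equiv _

theorem matHH_transpose : matHHᵀ = matHH := by
  ext x y
  simp only [transpose_apply, matHH_apply, and_comm]

theorem matHH_conjTranspose : matHHᴴ = matHH := by
  ext x y
  simp only [conjTranspose_apply, matHH_apply, and_comm]
  split_ifs <;> simp


/-! ### The monoid of circuit matrices -/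

/-- The matrices of the `N`-qubit circuits over `{X, CX, CCX, H ⊗ H}`. -/
def circuitMatrices (N : ℕ) : Submonoid (Matrix (Bits N) (Bits N) ℂ) where
  carrier := {A | ∃ C : Circuit integralGates N, C.eval = A}
  one_mem' := ⟨.id, rfl⟩
  mul_mem' := by
    rintro _ _ ⟨C, rfl⟩ ⟨D, rfl⟩
    exact ⟨.comp C D, rfl⟩

theorem placeMat_matHH_mem {N : ℕ} (w : Fin 2 ↪ Fin N) : placeMat matHH w ∈ circuitMatrices N :=
  ⟨.gate gateHH (by simp [integralGates]) w, rfl⟩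

theorem cflip_cflip {N : ℕ} {S : Finset (Fin N)} {t : Fin N} (h : t ∉ S) :
    Function.Involutive (cflip S t) := by
  intro x
  by_cases hx : ∀ s ∈ S, x s = 1
  · have h2 : ∀ s ∈ S, Function.update x t (x t + 1) s = 1 := fun s hs => by
      rw [Function.update_of_ne (fun e : s = t => h (e ▸ hs)), hx s hs]
    rw [cflip, cflip, if_pos hx, if_pos h2]
    simp [fin_two_add_one_add_one]
  · rw [cflip, cflip, if_neg hx, if_neg hx]

/-- With at most two controls, the controlled bit flip is a single gate. -/
theorem funMat_cflip_mem_of_card_le_two {N : ℕ} {S : Finset (Fin N)} {t : Fin N} (ht : t ∉ S)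
    (hS : S.card ≤ 2) : funMat (cflip S t) ∈ circuitMatrices N := by
  have h3 : S.card = 0 ∨ S.card = 1 ∨ S.card = 2 := by omega
  rcases h3 with h | h | h
  · rw [Finset.card_eq_zero] at h
    subst h
    have := placeMat_funMat_cflip ∅ (0 : Fin 1) ⟨fun _ => t, Function.injective_of_subsingleton _⟩
    exact ⟨.gate gateX (by simp [integralGates]) ⟨fun _ => t, fun (a b : Fin 1) _ =>
      Subsingleton.elim a b⟩, (congrArg (placeMat · _) gateX_mat).trans this⟩
  · obtain ⟨a, rfl⟩ := Finset.card_eq_one.mp h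
    have hat : a ≠ t := fun e => ht (by simp [e])
    let w : Fin 2 ↪ Fin N := ⟨![a, t], by
      intro i j
      fin_cases i <;> fin_cases j <;> simp [hat, hat.symm]⟩
    have := placeMat_funMat_cflip {0} (1 : Fin 2) w
    refine ⟨.gate gateCX (by simp [integralGates]) w,
      (congrArg (placeMat · _) gateCX_mat).trans (this.trans ?_)⟩
    rw [Finset.map_singleton]
    rfl
  · obtain ⟨a, b, hab, rfl⟩ := Finset.card_eq_two.mp h
    have hat : a ≠ t := fun e => ht (by simp [e])
    have hbt : b ≠ t := fun e => ht (by simp [e])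
    let w : Fin 3 ↪ Fin N := ⟨![a, b, t], by
      intro i j
      fin_cases i <;> fin_cases j <;> simp [hat, hat.symm, hbt, hbt.symm, hab, hab.symm]⟩
    have := placeMat_funMat_cflip {0, 1} (2 : Fin 3) w
    refine ⟨.gate gateCCX (by simp [integralGates]) w,
      (congrArg (placeMat · _) gateCCX_mat).trans (this.trans ?_)⟩
    rw [Finset.map_insert, Finset.map_singleton]
    rfl

/-- Controlled bit flips that leave some wire unused are circuit matrices: the unused wire `a` is
borrowed to split the controls into two smaller sets. -/
theorem funMat_cflip_mem {N : ℕ} {a t : Fin N} (hat : a ≠ t) {S : Finset (Fin N)} (ha : a ∉ S)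
    (ht : t ∉ S) : funMat (cflip S t) ∈ circuitMatrices N := by
  induction hc : S.card using Nat.strong_induction_on generalizing S a t with
  | _ c ih =>
    by_cases h2 : c ≤ 2
    · exact funMat_cflip_mem_of_card_le_two ht (by omega)
    · obtain ⟨A, hAS, hA⟩ := Finset.exists_subset_card_eq (show 2 ≤ S.card by omega)
      have hB : (S \ A).card = c - 2 := by rw [Finset.card_sdiff_of_subset hAS, hA, hc]
      obtain ⟨d, hd⟩ := Finset.card_pos.mp (show 0 < A.card by omega)
      have hdB : d ∉ S \ A := fun h => (Finset.mem_sdiff.mp h).2 hd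
      have haA : a ∉ A := fun h => ha (hAS h)
      have htA : t ∉ A := fun h => ht (hAS h)
      have haB : a ∉ S \ A := fun h => ha (Finset.mem_sdiff.mp h).1
      have htB : t ∉ S \ A := fun h => ht (Finset.mem_sdiff.mp h).1
      have h := cflip_union A (S \ A) hat haA htA haB htB
      rw [Finset.union_sdiff_of_subset hAS] at h
      have hda : d ≠ a := fun e => haA (e ▸ hd)
      have hdt : d ≠ t := fun e => htA (e ▸ hd)
      have m1 : funMat (cflip A a) ∈ circuitMatrices N :=
        funMat_cflip_mem_of_card_le_two haA (by omega)
      have m2 : funMat (cflip (insert a (S \ A)) t) ∈ circuitMatrices N := by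
        refine ih (c - 1) (by omega) (a := d) hdt ?_ ?_ ?_
        · simp [hda, hdB]
        · simp [hat.symm, htB]
        · rw [Finset.card_insert_of_notMem haB, hB]
          omega
      rw [← h, ← funMat_mul, ← funMat_mul]
      exact mul_mem (mul_mem m2 m1) (mul_mem m2 m1)

theorem funMat_involution {α : Type} [Fintype α] [DecidableEq α] {f : α → α}
    (hf : Function.Involutive f) : (funMat f)ᴴ = funMat f ∧ funMat f * funMat f = 1 ∧
      ∀ x y, funMat f x y ∈ dyadic := by
  refine ⟨?_, ?_, fun x y => ?_⟩
  · have := funMat_conjTranspose hf.toPerm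
    rwa [Equiv.Perm.inv_def, hf.toPerm_symm] at this
  · rw [funMat_mul, hf.comp_self, funMat_id]
  · rw [funMat]
    split_ifs
    exacts [dyadic.one_mem, dyadic.zero_mem]

theorem integralGates_mat {G : Gate} (hG : G ∈ integralGates) :
    G.matᴴ = G.mat ∧ G.mat * G.mat = 1 ∧ ∀ x y, G.mat x y ∈ dyadic := by
  simp only [integralGates, Set.mem_insert_iff, Set.mem_singleton_iff] at hG
  rcases hG with rfl | rfl | rfl | rfl
  · rw [gateX_mat]
    exact funMat_involution (cflip_cflip (by simp))
  · rw [gateCX_mat]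
    exact funMat_involution (cflip_cflip (by simp))
  · rw [gateCCX_mat]
    exact funMat_involution (cflip_cflip (by decide))
  · refine ⟨matHH_conjTranspose, matHH_mul_matHH, fun x y => ?_⟩
    have h := matHH_apply x y
    have half : (1 / 2 : ℂ) ∈ dyadic := ⟨1, 1, by simp⟩
    change matHH x y ∈ dyadic
    rw [h]
    refine dyadic.mul_mem half (dyadic.mul_mem ?_ ?_) <;> split_ifs
    exacts [dyadic.neg_mem dyadic.one_mem, dyadic.one_mem, dyadic.neg_mem dyadic.one_mem,
      dyadic.one_mem]

theorem place_integralGates {G : Gate} (hG : G ∈ integralGates) {N : ℕ} (w : Fin G.arity ↪ Fin N) :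
    (place G w)ᴴ = place G w ∧ place G w ∈ unitaryOver (Bits N) dyadic := by
  obtain ⟨h1, h2, h3⟩ := integralGates_mat hG
  have hs : (place G w)ᴴ = place G w := by rw [place_eq_placeMat, placeMat_conjTranspose, h1]
  refine ⟨hs, ?_, fun x y => ?_⟩
  · rw [mem_unitaryGroup_iff, star_eq_conjTranspose, hs, place_eq_placeMat, placeMat_mul, h2,
      placeMat_one]
  · rw [place]
    split_ifs
    exacts [h3 _ _, dyadic.zero_mem]

theorem one_mem_unitaryOver {ι : Type} [Fintype ι] [DecidableEq ι] (R : Subring ℂ) :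
    (1 : Matrix ι ι ℂ) ∈ unitaryOver ι R := by
  refine ⟨one_mem _, fun i j => ?_⟩
  rw [Matrix.one_apply]
  split_ifs
  exacts [R.one_mem, R.zero_mem]

theorem circuit_eval_mem_unitaryOver {N : ℕ} (C : Circuit integralGates N) :
    C.eval ∈ unitaryOver (Bits N) dyadic := by
  induction C with
  | id => exact one_mem_unitaryOver _
  | gate G hG w => exact (place_integralGates hG w).2
  | comp C D hC hD => exact unitaryOver_mul hC hD

theorem conjTranspose_mem_circuitMatrices {N : ℕ} {A : Matrix (Bits N) (Bits N) ℂ}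
    (hA : A ∈ circuitMatrices N) : Aᴴ ∈ circuitMatrices N := by
  obtain ⟨C, rfl⟩ := hA
  induction C with
  | id => exact ⟨.id, conjTranspose_one.symm⟩
  | gate G hG w => exact ⟨.gate G hG w, (place_integralGates hG w).1.symm⟩
  | comp C D hC hD =>
    rw [Circuit.eval, conjTranspose_mul]
    exact mul_mem hD hC

/-! ### Matrices that act on all wires but the last -/

/-- Splitting off the last bit. -/
def splitLast (n : ℕ) : Bits (n + 1) ≃ Bits n × Fin 2 where
  toFun x := (Fin.init x, x (Fin.last n))
  invFun p := Fin.snoc p.1 p.2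
  left_inv x := by simp
  right_inv p := by simp

/-- The matrix `A ⊗ B` on `n + 1` qubits. -/
def tensorLast {n : ℕ} (A : Matrix (Bits n) (Bits n) ℂ) (B : Matrix (Fin 2) (Fin 2) ℂ) :
    Matrix (Bits (n + 1)) (Bits (n + 1)) ℂ :=
  (A ⊗ₖ B).submatrix (splitLast n) (splitLast n)

theorem tensorLast_apply {n : ℕ} (A : Matrix (Bits n) (Bits n) ℂ) (B : Matrix (Fin 2) (Fin 2) ℂ)
    (x y : Bits (n + 1)) : tensorLast A B x y =
      A (Fin.init x) (Fin.init y) * B (x (Fin.last n)) (y (Fin.last n)) := rfl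

theorem tensorLast_mul {n : ℕ} (A A' : Matrix (Bits n) (Bits n) ℂ)
    (B B' : Matrix (Fin 2) (Fin 2) ℂ) :
    tensorLast A B * tensorLast A' B' = tensorLast (A * A') (B * B') := by
  rw [tensorLast, tensorLast, tensorLast, submatrix_mul_equiv, ← mul_kronecker_mul]

theorem tensorLast_one {n : ℕ} :
    tensorLast (1 : Matrix (Bits n) (Bits n) ℂ) (1 : Matrix (Fin 2) (Fin 2) ℂ) = 1 := by
  rw [tensorLast, one_kronecker_one, submatrix_one_equiv]

theorem tensorLast_conjTranspose {n : ℕ} (A : Matrix (Bits n) (Bits n) ℂ)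
    (B : Matrix (Fin 2) (Fin 2) ℂ) : (tensorLast A B)ᴴ = tensorLast Aᴴ Bᴴ := by
  rw [tensorLast, conjTranspose_submatrix, conjTranspose_kronecker]
  rfl

theorem placeMat_castSucc {k n : ℕ} (A : Matrix (Bits k) (Bits k) ℂ) (w : Fin k ↪ Fin n) :
    placeMat A (w.trans Fin.castSuccEmb) = tensorLast (placeMat A w) 1 := by
  ext x y
  have h : (∀ i, (∀ a, (w.trans Fin.castSuccEmb) a ≠ i) → x i = y i) ↔
      (∀ i, (∀ a, w a ≠ i) → Fin.init x i = Fin.init y i) ∧ x (Fin.last n) = y (Fin.last n) := by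
    rw [Fin.forall_fin_succ']
    refine and_congr ?_ ?_
    · simp [Fin.init]
    · simp [Fin.castSucc_ne_last]
  rw [tensorLast_apply, placeMat, if_congr h rfl rfl, placeMat, Matrix.one_apply, ite_and]
  split_ifs <;> simp [Fin.init]

/-- The matrices `A` on `n` qubits such that `A ⊗ 1` is the matrix of a circuit on `n + 1` qubits. -/
def liftable (n : ℕ) : Submonoid (Matrix (Bits n) (Bits n) ℂ) where
  carrier := {A | tensorLast A 1 ∈ circuitMatrices (n + 1)}
  one_mem' := by
    rw [Set.mem_ofPred_eq, tensorLast_one]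
    exact one_mem _
  mul_mem' := by
    intro A B hA hB
    have := (circuitMatrices (n + 1)).mul_mem hA hB
    rwa [tensorLast_mul, one_mul] at this

theorem mem_liftable {n : ℕ} {A : Matrix (Bits n) (Bits n) ℂ} :
    A ∈ liftable n ↔ tensorLast A 1 ∈ circuitMatrices (n + 1) := Iff.rfl

theorem conjTranspose_mem_liftable {n : ℕ} {A : Matrix (Bits n) (Bits n) ℂ}
    (hA : A ∈ liftable n) : Aᴴ ∈ liftable n := by
  have := conjTranspose_mem_circuitMatrices hA
  rwa [tensorLast_conjTranspose, conjTranspose_one] at this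

theorem mem_unitaryOver_of_mem_liftable {n : ℕ} {A : Matrix (Bits n) (Bits n) ℂ}
    (hA : A ∈ liftable n) : A ∈ unitaryOver (Bits n) dyadic := by
  obtain ⟨C, hC⟩ := mem_liftable.mp hA
  have h := circuit_eval_mem_unitaryOver C
  rw [hC] at h
  have e : ∀ (B : Matrix (Bits n) (Bits n) ℂ) (x y : Bits n),
      tensorLast B 1 ((splitLast n).symm (x, 0)) ((splitLast n).symm (y, 0)) = B x y := by
    intro B x y
    simp [tensorLast]
  refine ⟨?_, fun x y => ?_⟩
  · have h1 := h.1
    rw [mem_unitaryGroup_iff, star_eq_conjTranspose, tensorLast_conjTranspose, conjTranspose_one,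
      tensorLast_mul, one_mul, ← tensorLast_one] at h1
    rw [mem_unitaryGroup_iff, star_eq_conjTranspose]
    ext x y
    rw [← e (A * Aᴴ), h1, e]
  · rw [← e A]
    exact h.2 _ _

theorem placeMat_refl {n : ℕ} (A : Matrix (Bits n) (Bits n) ℂ) :
    placeMat A (Function.Embedding.refl _) = A := by
  ext x y
  simp [placeMat]

/-- The added last wire is the borrowed one, so `S` may consist of all wires other than `t`. -/
theorem funMat_cflip_mem_liftable {n : ℕ} {S : Finset (Fin n)} {t : Fin n} (ht : t ∉ S) :
    funMat (cflip S t) ∈ liftable n := by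
  have h := placeMat_castSucc (funMat (cflip S t)) (Function.Embedding.refl _)
  rw [placeMat_refl, placeMat_funMat_cflip] at h
  rw [mem_liftable, ← h]
  refine funMat_cflip_mem (a := Fin.last n) (Fin.castSucc_ne_last t).symm ?_ ?_
  · simp [Fin.castSucc_ne_last]
  · simpa using ht

/-! ### Permutation matrices -/

/-- The permutations of the basis states that are liftable. -/
def liftablePerms (n : ℕ) : Subgroup (Equiv.Perm (Bits n)) where
  carrier := {σ | funMat σ ∈ liftable n}
  one_mem' := by
    rw [Set.mem_ofPred_eq, Equiv.Perm.coe_one, funMat_id]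
    exact one_mem _
  mul_mem' := by
    intro σ τ hσ hτ
    rw [Set.mem_ofPred_eq, Equiv.Perm.coe_mul, ← funMat_mul]
    exact mul_mem hσ hτ
  inv_mem' := by
    intro σ hσ
    rw [Set.mem_ofPred_eq, ← funMat_conjTranspose]
    exact conjTranspose_mem_liftable hσ

theorem mem_liftablePerms {n : ℕ} {σ : Equiv.Perm (Bits n)} :
    σ ∈ liftablePerms n ↔ funMat σ ∈ liftable n := Iff.rfl

theorem addRight_mem_liftablePerms {n : ℕ} (b : Bits n) :
    Equiv.addRight b ∈ liftablePerms n := by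
  have hs : ∀ i (c : Fin 2), Equiv.addRight (Pi.single i c : Bits n) ∈ liftablePerms n := by
    intro i c
    have hc : c = 0 ∨ c = 1 := by revert c; decide
    rcases hc with rfl | rfl
    · rw [Pi.single_zero, Equiv.addRight_zero]
      exact one_mem _
    · have : ⇑(Equiv.addRight (Pi.single i 1 : Bits n)) = cflip ∅ i := by
        funext x j
        by_cases h : j = i
        · subst h
          simp [cflip]
        · simp [cflip, h]
      rw [mem_liftablePerms, this]
      exact funMat_cflip_mem_liftable (by simp)
  suffices H : ∀ F : Finset (Fin n), Equiv.addRight (∑ i ∈ F, Pi.single i (b i)) ∈ liftablePerms n by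
    have := H Finset.univ
    rwa [Finset.univ_sum_single] at this
  intro F
  induction F using Finset.induction_on with
  | empty =>
    rw [Finset.sum_empty, Equiv.addRight_zero]
    exact one_mem _
  | insert i F hi ih =>
    have : Equiv.addRight (∑ i ∈ insert i F, Pi.single i (b i) : Bits n) =
        Equiv.addRight (∑ i ∈ F, Pi.single i (b i)) * Equiv.addRight (Pi.single i (b i)) := by
      ext1 x
      simp [Finset.sum_insert hi, add_assoc]
    rw [this]
    exact mul_mem ih (hs _ _)

theorem cflip_erase_eq_swap {n : ℕ} (t : Fin n) :
    cflip (Finset.univ.erase t) t = Equiv.swap (1 : Bits n) (1 + Pi.single t 1) := by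
  funext x
  by_cases hx : ∀ s ∈ Finset.univ.erase t, x s = 1
  · have hx' : x = Function.update (1 : Bits n) t (x t) := by
      funext s
      by_cases hs : s = t
      · subst hs
        simp
      · simp [hs, hx s (by simp [hs])]
    have hu : ∀ c : Fin 2, Function.update (1 : Bits n) t (1 + c) = 1 + Pi.single t c := by
      intro c
      funext s
      by_cases hs : s = t
      · subst hs
        simp
      · simp [hs]
    rw [cflip, if_pos hx, hx', ← hu]
    have hc : x t = 1 ∨ x t = 1 + 1 := by
      generalize x t = c
      revert c
      decide
    have h1 : (1 : Bits n) = Function.update (1 : Bits n) t 1 := by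
      rw [← Pi.one_apply (M := fun _ => Fin 2) t, Function.update_eq_self]
    rcases hc with h | h
    · rw [h, ← h1, Equiv.swap_apply_left]
      simp
    · rw [h, Equiv.swap_apply_right]
      simp only [Function.update_self, Function.update_idem, fin_two_add_one_add_one]
      exact h1.symm
  · rw [cflip, if_neg hx, Equiv.swap_apply_of_ne_of_ne]
    · rintro rfl
      exact hx fun _ _ => rfl
    · rintro rfl
      refine hx fun s hs => ?_
      simp [Finset.ne_of_mem_erase hs]

/-- The fully controlled flip is a transposition along one edge of the hypercube at the all-ones
string. Translations by bit strings carry it to every edge in that direction, and paths of edges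
yield every transposition. -/
theorem liftablePerms_eq_top (n : ℕ) : liftablePerms n = ⊤ := by
  have h1 : ∀ (x : Bits n) t, Equiv.swap x (x + Pi.single t 1) ∈ liftablePerms n := by
    intro x t
    have h : Equiv.swap (1 : Bits n) (1 + Pi.single t 1) ∈ liftablePerms n := by
      rw [mem_liftablePerms, ← cflip_erase_eq_swap]
      exact funMat_cflip_mem_liftable (by simp)
    have hσ := addRight_mem_liftablePerms (x - 1)
    have := mul_mem (mul_mem hσ h) (inv_mem hσ)
    rw [← Equiv.swap_apply_apply, Equiv.coe_addRight] at this
    dsimp only at this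
    rwa [add_right_comm, add_sub_cancel] at this
  have h2 : ∀ (x : Bits n) t (c : Fin 2), Equiv.swap x (x + Pi.single t c) ∈ liftablePerms n := by
    intro x t c
    have hc : c = 0 ∨ c = 1 := by revert c; decide
    rcases hc with rfl | rfl
    · rw [Pi.single_zero, add_zero, Equiv.swap_self]
      exact one_mem _
    · exact h1 x t
  have h3 : ∀ x y : Bits n, Equiv.swap x y ∈ liftablePerms n := by
    intro x y
    suffices H : ∀ F : Finset (Fin n),
        Equiv.swap x (x + ∑ i ∈ F, Pi.single i ((y - x) i)) ∈ liftablePerms n by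
      have := H Finset.univ
      rwa [Finset.univ_sum_single, add_sub_cancel] at this
    intro F
    induction F using Finset.induction_on with
    | empty =>
      rw [Finset.sum_empty, add_zero, Equiv.swap_self]
      exact one_mem _
    | insert i F hi ih =>
      rw [Finset.sum_insert hi, add_comm (Pi.single i _), ← add_assoc]
      exact SubmonoidClass.swap_mem_trans _ ih (h2 _ i _)
  rw [eq_top_iff, ← Equiv.Perm.closure_isSwap, Subgroup.closure_le]
  rintro σ ⟨x, y, _, rfl⟩
  exact h3 x y

theorem funMat_perm_mem_liftable {n : ℕ} (σ : Equiv.Perm (Bits n)) : funMat σ ∈ liftable n :=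
  mem_liftablePerms.mp (by rw [liftablePerms_eq_top]; trivial)

theorem refl_funMat_mem_liftable {n : ℕ} {c : ℂ} {w : Bits n → ℂ} (h : refl c w ∈ liftable n)
    (σ : Equiv.Perm (Bits n)) : refl c (funMat σ *ᵥ w) ∈ liftable n := by
  rw [← refl_conj _ _ (funMat_mul_transpose σ), funMat_transpose]
  exact mul_mem (mul_mem (funMat_perm_mem_liftable σ) h) (funMat_perm_mem_liftable _)


/-! ### Sign changes and four-level reflections -/

/-- The Hadamard matrix on the wire `t`. -/
def hadamardOn {n : ℕ} (t : Fin n) : Matrix (Bits n) (Bits n) ℂ :=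
  placeMat (matH.submatrix (fun x : Bits 1 => x 0) (fun x => x 0))
    ⟨fun _ => t, Function.injective_of_subsingleton _⟩

theorem hadamardOn_apply {n : ℕ} (t : Fin n) (x y : Bits n) :
    hadamardOn t x y = if ∀ i, t ≠ i → x i = y i then matH (x t) (y t) else 0 := by
  simp [hadamardOn, placeMat]

theorem hadamardOn_mul_self {n : ℕ} (t : Fin n) : hadamardOn t * hadamardOn t = 1 := by
  have h : matH.submatrix (fun x : Bits 1 => x 0) (fun x => x 0) =
      matH.submatrix (Equiv.funUnique (Fin 1) (Fin 2)) (Equiv.funUnique (Fin 1) (Fin 2)) := rfl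
  rw [hadamardOn, placeMat_mul, h, submatrix_mul_equiv, matH_mul_matH, submatrix_one_equiv,
    placeMat_one]

theorem hadamardOn_transpose {n : ℕ} (t : Fin n) : (hadamardOn t)ᵀ = hadamardOn t := by
  rw [hadamardOn, placeMat_transpose, transpose_submatrix, matH_transpose]

/-- The Hadamard gates on the wire `t` and on the last wire. -/
theorem tensorLast_hadamardOn_mem {n : ℕ} (t : Fin n) :
    tensorLast (hadamardOn t) matH ∈ circuitMatrices (n + 1) := by
  let w : Fin 2 ↪ Fin (n + 1) := ⟨![t.castSucc, Fin.last n], by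
    intro i j
    fin_cases i <;> fin_cases j <;> simp [Fin.castSucc_ne_last, (Fin.castSucc_ne_last _).symm]⟩
  have h : tensorLast (hadamardOn t) matH = placeMat matHH w := by
    ext x y
    have h : (∀ i, (∀ a, w a ≠ i) → x i = y i) ↔
        ∀ i, t ≠ i → Fin.init x i = Fin.init y i := by
      have h0 : w 0 = t.castSucc := rfl
      have h1 : w 1 = Fin.last n := rfl
      rw [Fin.forall_fin_succ']
      simp [h0, h1, Fin.forall_fin_two, Fin.init, (Fin.castSucc_ne_last _).symm]
    have h2 : matHH (fun a => x (w a)) (fun a => y (w a)) =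
        matH (x t.castSucc) (y t.castSucc) * matH (x (Fin.last n)) (y (Fin.last n)) := rfl
    rw [placeMat, if_congr h rfl rfl, tensorLast_apply, hadamardOn_apply, h2]
    split_ifs <;> simp [Fin.init]
  rw [h]
  exact placeMat_matHH_mem w

/-- A lone `H` is not available, but its partners on the last wire meet across `A ⊗ 1` and cancel.
-/
theorem hadamardOn_conj_mem_liftable {n : ℕ} (t : Fin n) {A : Matrix (Bits n) (Bits n) ℂ}
    (hA : A ∈ liftable n) : hadamardOn t * A * hadamardOn t ∈ liftable n := by
  have h := tensorLast_hadamardOn_mem t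
  have := mul_mem (mul_mem h (mem_liftable.mp hA)) h
  rwa [tensorLast_mul, tensorLast_mul, mul_one, matH_mul_matH] at this

/-- `H` diagonalizes the swap of two strings differing in one bit: it sends their difference vector
to `√2` times a basis vector. A permutation then moves the sign to `x`. A wire is needed to carry
`H`, hence `1 ≤ n`. -/
theorem refl_two_single_mem_liftable {n : ℕ} (hn : 1 ≤ n) (x : Bits n) :
    refl 2 (Pi.single x 1) ∈ liftable n := by
  let t : Fin n := ⟨0, hn⟩
  let q : Bits n := Pi.single t 1
  have hq0 : (0 : Bits n) ≠ q := fun h => by simpa [q] using congrFun h t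
  have hswap : refl 1 (Pi.single 0 1 - Pi.single q 1) ∈ liftable n := by
    rw [← funMat_swap hq0]
    exact funMat_perm_mem_liftable _
  have hvec : hadamardOn t *ᵥ (Pi.single 0 1 - Pi.single q 1) =
      (2 * ((1 / Real.sqrt 2 : ℝ) : ℂ)) • Pi.single q 1 := by
    ext z
    have hz : (∀ i, t ≠ i → z i = q i) ↔ ∀ i, t ≠ i → z i = (0 : Bits n) i :=
      forall₂_congr fun i hi => by simp [q, hi.symm]
    have hzq : z = q ↔ (∀ i, t ≠ i → z i = (0 : Bits n) i) ∧ z t = 1 := by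
      rw [← hz]
      constructor
      · rintro rfl
        simp [q]
      · rintro ⟨h1, h2⟩
        funext i
        by_cases hi : t = i
        · subst hi
          simp [h2, q]
        · exact h1 i hi
    rw [mulVec_sub, Pi.sub_apply, mulVec_single_one, mulVec_single_one, col_apply, col_apply,
      hadamardOn_apply, hadamardOn_apply, if_congr hz rfl rfl, Pi.smul_apply, Pi.single_apply,
      if_congr hzq rfl rfl, matH_apply, matH_apply]
    have hqt : q t = 1 := by simp [q]
    rw [hqt]
    generalize z t = b
    have hb : b = 0 ∨ b = 1 := by revert b; decide
    rcases hb with rfl | rfl <;> simp [-ne_eq]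
    split_ifs <;> ring
  have hmem := hadamardOn_conj_mem_liftable t hswap
  have hconj := refl_conj 1 (Pi.single 0 1 - Pi.single q 1) (U := hadamardOn t)
    (by rw [hadamardOn_transpose, hadamardOn_mul_self])
  rw [hadamardOn_transpose] at hconj
  rw [hconj, hvec, refl_smul] at hmem
  have hc : 1 * (2 * ((1 / Real.sqrt 2 : ℝ) : ℂ)) ^ 2 = 2 := by
    linear_combination 4 * inv_sqrt_two_mul_self
  rw [hc] at hmem
  have := refl_funMat_mem_liftable hmem (Equiv.swap q x)
  rwa [funMat_mulVec_single, Equiv.swap_apply_left] at this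

/-- `H ⊗ H` sends a basis vector to half a sum of four, so a sign change is conjugated to a
reflection with coefficient `2 * (1 / 2) ^ 2`. Four distinct strings force `2 ≤ n`. -/
theorem refl_half_mem_liftable {n : ℕ} (f : Fin 4 ↪ Bits n) :
    refl (1 / 2) (∑ a, Pi.single (f a) 1) ∈ liftable n := by
  have hn : 2 ≤ n := by
    have := Fintype.card_le_of_embedding f
    simp only [Fintype.card_fin, Fintype.card_fun] at this
    by_contra! h
    interval_cases n <;> simp at this
  let w : Fin 2 ↪ Fin n := Fin.castLEEmb hn
  let g : Bits 2 → Bits n := fun b => (splitWires w).symm (b, 0)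
  have hg : Function.Injective g := fun b c h => by simpa [g] using h
  have hvec : placeMat matHH w *ᵥ Pi.single 0 1 = (1 / 2 : ℂ) • ∑ b, Pi.single (g b) 1 := by
    ext z
    have hz : ∀ b, z = g b ↔ (splitWires w z).1 = b ∧ (splitWires w z).2 = 0 := fun b => by
      rw [Equiv.eq_symm_apply, Prod.ext_iff]
    have h2 : (∀ i, (∀ a, w a ≠ i) → z i = (0 : Bits n) i) ↔ (splitWires w z).2 = 0 := by
      simp [splitWires, funext_iff]
    rw [mulVec_single_one, col_apply, placeMat, if_congr h2 rfl rfl, matHH_apply, Pi.smul_apply,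
      Finset.sum_apply]
    simp [Pi.single_apply, hz, ite_and]
  have hmem : refl (1 / 2) (∑ b, Pi.single (g b) 1) ∈ liftable n := by
    have hU : placeMat matHH w ∈ liftable n := by
      rw [mem_liftable, ← placeMat_castSucc]
      exact placeMat_matHH_mem _
    have hUt : (placeMat matHH w)ᵀ = placeMat matHH w := by
      rw [placeMat_transpose, matHH_transpose]
    have := mul_mem (mul_mem hU (refl_two_single_mem_liftable (by omega) 0)) hU
    have hconj := refl_conj 2 (Pi.single 0 1) (U := placeMat matHH w)
      (by rw [hUt, placeMat_mul, matHH_mul_matHH, placeMat_one])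
    rw [hUt] at hconj
    rw [hconj, hvec, refl_smul] at this
    norm_num at this ⊢
    exact this
  let e : Bits 2 ≃ Fin 4 := finFunctionFinEquiv
  -- Permutations act transitively on injective 4-tuples, so this one reflection gives all of them.
  obtain ⟨σ, hσ⟩ := Equiv.Perm.exists_smul_eq_embedding
    (⟨fun a => g (e.symm a), hg.comp e.symm.injective⟩ : Fin 4 ↪ Bits n) f
  have hσ' : ∀ b, σ (g b) = f (e b) := fun b => by
    rw [← hσ]
    simp
  have := refl_funMat_mem_liftable hmem σ
  rw [mulVec_sum] at this
  simp only [funMat_mulVec_single, hσ'] at this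
  rwa [Equiv.sum_comp e fun a => (Pi.single (f a) 1 : Bits n → ℂ)] at this

theorem mem_liftable_of_mem_unitaryOver {n : ℕ} (hn : 1 ≤ n) {V : Matrix (Bits n) (Bits n) ℂ}
    (hV : V ∈ unitaryOver (Bits n) dyadic) : V ∈ liftable n :=
  mem_of_mem_unitaryOver_dyadic (fun _ => mem_unitaryOver_of_mem_liftable)
    (fun _ => conjTranspose_mem_liftable) (refl_two_single_mem_liftable hn)
    (fun i j hij => by
      rw [← funMat_swap hij]
      exact funMat_perm_mem_liftable _)
    refl_half_mem_liftable hV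

/-! ### Representability -/

theorem tensorVec_snoc {n : ℕ} (ψ : Bits n → ℂ) (φ : Bits 1 → ℂ) (y : Bits n) (b : Fin 2) :
    tensorVec ψ φ ((splitLast n).symm (y, b)) = ψ y * φ fun _ => b := by
  have h1 : (fun i => (splitLast n).symm (y, b) (Fin.castAdd 1 i)) = y :=
    Fin.init_snoc (α := fun _ => Fin 2) b y
  have h2 : (fun j => (splitLast n).symm (y, b) (Fin.natAdd n j)) = fun _ : Fin 1 => b := by
    funext j
    rw [Subsingleton.elim j 0]
    exact Fin.snoc_last (α := fun _ => Fin 2) b y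
  rw [tensorVec, h1, h2]

theorem tensorLast_mulVec_tensorVec {n : ℕ} (A : Matrix (Bits n) (Bits n) ℂ) (ψ : Bits n → ℂ)
    (φ : Bits 1 → ℂ) : tensorLast A 1 *ᵥ tensorVec ψ φ = tensorVec (A *ᵥ ψ) φ := by
  funext x
  obtain ⟨⟨x, a⟩, rfl⟩ := (splitLast n).symm.surjective x
  rw [tensorVec_snoc, mulVec, dotProduct, ← Equiv.sum_comp (splitLast n).symm,
    Fintype.sum_prod_type]
  simp only [tensorVec_snoc, tensorLast, submatrix_apply, Equiv.apply_symm_apply,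
    kroneckerMap_apply, Matrix.one_apply, mulVec, dotProduct, Finset.sum_mul]
  refine Finset.sum_congr rfl fun y _ => ?_
  simp
  ring

theorem representableWith_one {n : ℕ} (hn : 1 ≤ n) {V : Matrix (Bits n) (Bits n) ℂ}
    (hV : V ∈ unitaryOver (Bits n) dyadic) : RepresentableWith integralGates 1 V := by
  obtain ⟨D, hD⟩ := mem_liftable.mp (mem_liftable_of_mem_unitaryOver hn hV)
  exact ⟨D, fun ψ _ => by rw [hD, tensorLast_mulVec_tensorVec]⟩

theorem smul_one_mem_circuitMatrices {c : ℂ}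
    (h : c • (1 : Matrix (Bits 1) (Bits 1) ℂ) ∈ unitaryOver (Bits 1) dyadic) :
    c • (1 : Matrix (Bits 2) (Bits 2) ℂ) ∈ circuitMatrices 2 := by
  have := mem_liftable.mp (mem_liftable_of_mem_unitaryOver le_rfl h)
  have h2 : tensorLast (c • (1 : Matrix (Bits 1) (Bits 1) ℂ)) 1 = c • 1 := by
    have h3 : tensorLast (c • (1 : Matrix (Bits 1) (Bits 1) ℂ)) 1 = c • tensorLast 1 1 := by
      rw [tensorLast, smul_kronecker]
      rfl
    rw [h3, tensorLast_one]
  rwa [h2] at this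

/-- Here `V` is a scalar. One ancilla plays the data qubit on which the scalar acts, and the second
is the extra wire of the one-qubit construction. -/
theorem representableWith_two_of_zero {V : Matrix (Bits 0) (Bits 0) ℂ}
    (hV : V ∈ unitaryOver (Bits 0) dyadic) : RepresentableWith integralGates 2 V := by
  have hVc : V = V default default • (1 : Matrix (Bits 0) (Bits 0) ℂ) := by
    ext i j
    rw [Subsingleton.elim i default, Subsingleton.elim j default]
    simp
  set c := V default default with hc
  have hcc : c * star c = 1 := by
    have h := (mem_unitaryGroup_iff).mp hV.1
    have h2 := congrFun (congrFun h default) default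
    rw [mul_apply, Fintype.sum_unique, star_eq_conjTranspose, conjTranspose_apply] at h2
    have e : ∀ i j, V i j = c := fun i j => by
      rw [hc, Subsingleton.elim i default, Subsingleton.elim j default]
    rwa [one_apply_eq, e] at h2
  have h1 : c • (1 : Matrix (Bits 1) (Bits 1) ℂ) ∈ unitaryOver (Bits 1) dyadic := by
    refine ⟨?_, fun i j => ?_⟩
    · rw [mem_unitaryGroup_iff, star_smul, star_one, smul_mul_smul_comm, hcc, one_mul, one_smul]
    · rw [Matrix.smul_apply, Matrix.one_apply, smul_eq_mul]
      refine mul_mem (hV.2 _ _) ?_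
      split_ifs
      exacts [dyadic.one_mem, dyadic.zero_mem]
  obtain ⟨D, hD⟩ : c • (1 : Matrix (Bits (0 + 2)) (Bits (0 + 2)) ℂ) ∈ circuitMatrices (0 + 2) :=
    smul_one_mem_circuitMatrices h1
  refine ⟨D, fun ψ _ => ?_⟩
  rw [hD, hVc, smul_mulVec, smul_mulVec, one_mulVec, one_mulVec]
  funext x
  simp [tensorVec, mul_assoc]

/-- Tested on basis states, the hypothesis says that the columns of `D` with zero ancillas are those
of `V` padded by zeros; orthonormality and dyadic entries are therefore inherited. -/
theorem mem_unitaryOver_of_represents {n m : ℕ} {D : Circuit integralGates (n + m)}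
    {V : Matrix (Bits n) (Bits n) ℂ} (h : Represents D V) : V ∈ unitaryOver (Bits n) dyadic := by
  obtain ⟨hU, hR⟩ := circuit_eval_mem_unitaryOver D
  let e : Bits n × Bits m ≃ Bits (n + m) := Fin.appendEquiv n m
  have hvec : ∀ (ψ : Bits n → ℂ) (φ : Bits m → ℂ) x z, tensorVec ψ φ (e (x, z)) = ψ x * φ z := by
    intro ψ φ x z
    simp [tensorVec, e, Fin.appendEquiv]
  have hket : ∀ y : Bits n,
      tensorVec (Pi.single y 1) (ketZero m) = Pi.single (e (y, fun _ => 0)) 1 := by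
    intro y
    funext x
    obtain ⟨⟨x, z⟩, rfl⟩ := e.surjective x
    rw [hvec, ketZero, Pi.single_apply, Pi.single_apply, Pi.single_apply,
      if_congr (e.injective.eq_iff.trans Prod.mk_inj) rfl rfl]
    by_cases h1 : x = y <;> by_cases h2 : z = fun _ => 0 <;> simp [h1, h2]
  have hcol : ∀ (x y : Bits n) (z : Bits m), D.eval (e (x, z)) (e (y, fun _ => 0)) =
      V x y * ketZero m z := by
    intro x y z
    have hs : IsState (Pi.single y 1 : Bits n → ℂ) := by
      rw [IsState, Finset.sum_eq_single y] <;> simp +contextual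
    have := congrFun (h _ hs) (e (x, z))
    rw [hket, hvec] at this
    simpa using this
  refine ⟨?_, fun x y => ?_⟩
  · rw [mem_unitaryGroup_iff'] at hU ⊢
    ext y y'
    have h2 := congrFun (congrFun hU (e (y, fun _ => 0))) (e (y', fun _ => 0))
    rw [star_eq_conjTranspose, mul_apply, ← Equiv.sum_comp e, Fintype.sum_prod_type] at h2
    simp only [conjTranspose_apply, hcol, Matrix.one_apply, e.injective.eq_iff, Prod.mk_inj,
      and_true] at h2
    rw [star_eq_conjTranspose, mul_apply, Matrix.one_apply, ← h2]
    refine Finset.sum_congr rfl fun x _ => ?_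
    rw [Finset.sum_eq_single (fun _ => 0)]
    · simp [ketZero, conjTranspose_apply]
    · intro z _ hz
      simp [ketZero, Pi.single_eq_of_ne hz]
    · simp
  · have := hR (e (x, fun _ => 0)) (e (y, fun _ => 0))
    rw [hcol] at this
    simpa [ketZero] using this

end QCircuit

end

theorem mainTheorem1 (n : ℕ) (V : Matrix (QCircuit.Bits n) (QCircuit.Bits n) ℂ) :
    (QCircuit.Representable QCircuit.integralGates V ↔
      V ∈ QCircuit.unitaryOver (QCircuit.Bits n) QCircuit.dyadic) ∧
    (1 ≤ n → V ∈ QCircuit.unitaryOver (QCircuit.Bits n) QCircuit.dyadic →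
      QCircuit.RepresentableWith QCircuit.integralGates 1 V) := by
  refine ⟨⟨?_, fun hV => ?_⟩, fun hn hV => QCircuit.representableWith_one hn hV⟩
  · rintro ⟨m, D, hD⟩
    exact QCircuit.mem_unitaryOver_of_represents hD
  · rcases Nat.eq_zero_or_pos n with rfl | hn
    · exact ⟨2, QCircuit.representableWith_two_of_zero hV⟩
    · exact ⟨1, QCircuit.representableWith_one hn hV⟩
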